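/- **Theorem (Stability of Multiplicities).** Let $H=\begin{pmatrix}1&0\\0&-1\end{pmatrix}$, $X=\begin{pmatrix}0&1\\0&0\end{pmatrix}$, $Y=\begin{pmatrix}0&0\\1&0\end{pmatrix}\in\mathfrak{sl}(2,\mathbb C)$. Let $G$ be a real reductive Lie group with complexified Lie algebra $\mathfrak{sl}(2,\mathbb C)$, more precisely a topological group with a continuous homomorphism $p\colon G\to SL(2,\mathbb C)$ that is a finite covering of a closed subgroup whose Lie algebra is a real form of $\mathfrak{sl}(2,\mathbb C)$; $G$ acts on $\mathbb C^2$ through $p$. Let $G'\subset G$ be a connected one-dimensional Lie subgroup whose complexified Lie algebra is $\mathbb CH$. For $\nu\in\mathbb C$ let $\mathbb C_\nu$ be the one-dimensional representation of $\mathbb CH$ with $H\mapsto\nu$, and also its lift to $G'$ when it exists. Let $\mathcal M(G)$ be the category of admissible smooth Fréchet representations of $G$ of finite length and moderate growth. For $\Pi\in\mathcal M(G)$ put $[\Pi:\mathbb C_\nu]=\dim\operatorname{Hom}_{G'}(\Pi|_{G'},\mathbb C_\nu)$ (continuous $G'$-homomorphisms; this is $0$ if $\mathbb C_\nu$ does not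 lift to $G'$). We say that $\Pi$ has infinitesimal character $\lambda\in\mathbb C$ if the Casimir element $\Omega=H^2+2(XY+YX)$ acts on $\Pi$ by the scalar $\lambda^2-1$, and $P_\lambda(V)$ denotes the generalized $(\lambda^2-1)$-eigenspace of $\Omega$ in $V$. For $\xi\in\mathbb C\setminus\{0\}$ let $\Lambda(\xi)$ be $\mathbb Z+\xi$ if $\xi\notin\mathbb Z$, $\{1,2,\dots\}$ if $\xi\in\{1,2,\dots\}$, and $\{-1,-2,\dots\}$ if $\xi\in\{-1,-2,\dots\}$. A *reduced coherent family* through $\Pi\in\mathcal M(G)$, where $\Pi$ has infinitesimal character $\xi\neq0$, is a family $\{\Pi_\lambda\in\mathcal M(G):\lambda\in\Lambda(\xi)\}$ such that $\Pi_\xi=\Pi$, each $\Pi_\lambda$ has infinitesimal character $\lambda$, and $P_{\mu}(\Pi_\lambda\otimes\mathbb C^2)\simeq\Pi_{\mu}$ whenever $\lambda,\mu\in\Lambda(\xi)$ and $\mu-\lambda\in\{1,-1\}$. Let $\{\Pi_\lambda:\lambda\in\Lambda(\xi)\}$ be a reduced coherent family through $\Pi$ with $\xi\ne0$, let $\eta\in\mathbb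 C$, and set $$\Xi=\{(\lambda,\nu)\in\Lambda(\xi)\times(\mathbb Z+\eta):(\lambda-\xi)-(\nu-\eta)\in2\mathbb Z\},$$ $$\Xi^{\uparrow}=\{(\lambda,\nu)\in\Xi:\operatorname{Re}\nu\ge|\operatorname{Re}\lambda|+1\},\qquad \Xi^{\rightarrow}=\{(\lambda,\nu)\in\Xi:\operatorname{Re}\lambda\ge|\operatorname{Re}\nu|+1\},$$ $$\Xi^{\downarrow}=\{(\lambda,\nu)\in\Xi:\operatorname{Re}\nu\le-|\operatorname{Re}\lambda|-1\},\qquad \Xi^{\leftarrow}=\{(\lambda,\nu)\in\Xi:\operatorname{Re}\lambda\le-|\operatorname{Re}\nu|-1\}.$$ 1. If $\xi-\eta\notin2\mathbb Z+1$ and $\xi+\eta\notin2\mathbb Z+1$ (for $\xi\in\mathbb Z$ these conditions are equivalent), then $[\Pi_\lambda:\mathbb C_\nu]=[\Pi:\mathbb C_\eta]$ for all $(\lambda,\nu)\in\Xi$. 2. Suppose $\xi-\eta\in2\mathbb Z+1$. If $\xi\in\mathbb Z$, then $(\xi,\eta)\in\Xi^s$ for some $s\in\{\uparrow,\rightarrow,\downarrow,\leftarrow\}$.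 For arbitrary $\xi$, whenever $(\xi,\eta)\in\Xi^s$, we have $[\Pi_\lambda:\mathbb C_\nu]=[\Pi:\mathbb C_\eta]$ for all $(\lambda,\nu)\in\Xi^s$. 3. Suppose $\xi\notin\mathbb Z$ and let $\sigma\in\{1,-1\}$ be such that $\xi-\sigma\eta\in2\mathbb Z+1$. Then $[\Pi_\lambda:\mathbb C_\nu]=[\Pi:\mathbb C_\eta]$ for all $(\lambda,\nu)\in\Xi$ such that the odd integers $\lambda-\sigma\nu$ and $\xi-\sigma\eta$ have the same sign. -/

import Mathlib

open Filter Topology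
open scoped Matrix

namespace Sl2Branching

noncomputable section

/-- The complex Lie algebra of traceless `2 × 2` matrices. -/
abbrev sl2 := LieAlgebra.SpecialLinear.sl (Fin 2) ℂ

/-- The element `diag(1, -1)`. -/
def H : sl2 := ⟨!![1, 0; 0, -1], by
  simp [LieAlgebra.SpecialLinear.sl, Matrix.trace_fin_two, LinearMap.mem_ker]⟩

/-- The upper nilpotent element. -/
def X : sl2 := ⟨!![0, 1; 0, 0], by
  simp [LieAlgebra.SpecialLinear.sl, Matrix.trace_fin_two, LinearMap.mem_ker]⟩

/-- The lower nilpotent element. -/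
def Y : sl2 := ⟨!![0, 0; 1, 0], by
  simp [LieAlgebra.SpecialLinear.sl, Matrix.trace_fin_two, LinearMap.mem_ker]⟩

/-- The Casimir operator `H² + 2 (X Y + Y X)` of an action `ρ` of `sl2`. -/
def casimir {W : Type*} [AddCommGroup W] [Module ℂ W] (ρ : sl2 → Module.End ℂ W) :
    Module.End ℂ W :=
  ρ H * ρ H + (2 : ℂ) • (ρ X * ρ Y + ρ Y * ρ X)

section Groups

variable {G : Type*} [Group G] [TopologicalSpace G] [IsTopologicalGroup G] [T2Space G]

/-- `γ` is a one-parameter subgroup of `G` lying over `t ↦ exp (t A)`. -/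
structure IsOneParam (p : G →* Matrix.SpecialLinearGroup (Fin 2) ℂ) (A : sl2) (γ : ℝ → G) :
    Prop where
  continuous : Continuous γ
  map_add : ∀ s t, γ (s + t) = γ s * γ t
  map_exp : ∀ t : ℝ, (p (γ t) : Matrix (Fin 2) (Fin 2) ℂ) =
    NormedSpace.exp ((t : ℂ) • (A : Matrix (Fin 2) (Fin 2) ℂ))

/-- The (real) Lie algebra of `G`, as a subset of `sl2`: the directions of the one-parameter
subgroups of `G`. -/
def realLie (p : G →* Matrix.SpecialLinearGroup (Fin 2) ℂ) : Set sl2 :=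
  {A | ∃ γ, IsOneParam p A γ}

end Groups

/-- A real reductive Lie group `G` whose complexified Lie algebra is `sl2`, acting on the natural
representation `ℂ²`: the homomorphism `p`, which gives the action on `ℂ²`, is a finite covering
of a closed subgroup of `SL(2, ℂ)` whose Lie algebra is a real form of `sl2`. If `p` is injective,
`G` is a closed subgroup such as `SU(2)`, `SL(2, ℝ)` or `SU(1, 1)`. -/
structure Sl2Group (G : Type*) [Group G] [TopologicalSpace G] [IsTopologicalGroup G]
    [T2Space G] where
  p : G →* Matrix.SpecialLinearGroup (Fin 2) ℂ
  continuous_p : Continuous p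
  isOpenMap_p : IsOpenMap p.rangeRestrict
  finite_ker : Finite p.ker
  isClosed_range : IsClosed (p.range : Set (Matrix.SpecialLinearGroup (Fin 2) ℂ))
  real_form : ∀ B : sl2, ∃! q : sl2 × sl2,
    q.1 ∈ realLie p ∧ q.2 ∈ realLie p ∧ B = q.1 + Complex.I • q.2

/-- A pair `G ⊃ G'` with complexified Lie algebras `sl2 ⊃ ℂ H`. The identification of the
complexified Lie algebra of `G` with `sl2` is chosen such that the complexified Lie algebra of
`G'` is spanned by the standard `H`. The connected group `G'` is the image of the one-parameter
subgroup `γ`, with real Lie algebra `ℝ c H`. -/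
structure Sl2Gl1Pair (G : Type*) [Group G] [TopologicalSpace G] [IsTopologicalGroup G]
    [T2Space G] extends Sl2Group G where
  c : ℂ
  c_ne_zero : c ≠ 0
  γ : ℝ → G
  isOneParam_γ : IsOneParam p (c • H) γ

section Representations

variable {G : Type*} [Group G] [TopologicalSpace G] [IsTopologicalGroup G] [T2Space G]

/-- A continuous representation `π` of `G` on a complex Fréchet space all of whose vectors are
smooth. Here `dπ` is the complexified differential of `π`; it is determined by `π` through
`hasDeriv`, since the Lie algebra of `G` spans `sl2` over `ℂ`. -/
structure SmoothRep (S : Sl2Group G) where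
  V : Type*
  [addCommGroup : AddCommGroup V]
  [module : Module ℂ V]
  [uniformSpace : UniformSpace V]
  [isUniformAddGroup : IsUniformAddGroup V]
  [continuousSMul : ContinuousSMul ℂ V]
  [locallyConvex : LocallyConvexSpace ℝ V]
  [t2 : T2Space V]
  [complete : CompleteSpace V]
  [firstCountable : FirstCountableTopology V]
  π : G →* (V →L[ℂ] V)
  continuous_act : Continuous fun x : G × V => π x.1 x.2
  dπ : sl2 →ₗ[ℂ] Module.End ℂ V
  dπ_lie : ∀ A B : sl2, dπ ⁅A, B⁆ = dπ A * dπ B - dπ B * dπ A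
  hasDeriv : ∀ (A : sl2) (γ : ℝ → G), IsOneParam S.p A γ → ∀ v : V,
    Tendsto (fun t : ℝ => ((t : ℂ)⁻¹) • (π (γ t) v - v)) (𝓝[≠] 0) (𝓝 (dπ A v))

attribute [instance] SmoothRep.addCommGroup SmoothRep.module SmoothRep.uniformSpace
  SmoothRep.isUniformAddGroup SmoothRep.continuousSMul SmoothRep.locallyConvex SmoothRep.t2
  SmoothRep.complete SmoothRep.firstCountable

namespace SmoothRep

variable {S : Sl2Group G}

/-- `W` is a closed `G`-invariant subspace. -/
def IsClosedInvariant (R : SmoothRep S) (W : Submodule ℂ R.V) : Prop :=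
  IsClosed (W : Set R.V) ∧ ∀ g, ∀ v ∈ W, R.π g v ∈ W

/-- Existence of a finite composition series of closed invariant subspaces. -/
def IsFiniteLength (R : SmoothRep S) : Prop :=
  ∃ (n : ℕ) (W : ℕ → Submodule ℂ R.V), W 0 = ⊥ ∧ W n = ⊤ ∧
    (∀ i ≤ n, R.IsClosedInvariant (W i)) ∧
    ∀ i < n, W i < W (i + 1) ∧
      ∀ U, R.IsClosedInvariant U → W i ≤ U → U ≤ W (i + 1) → U = W i ∨ U = W (i + 1)

/-- The space of `K`-homomorphisms from a finite-dimensional representation `σ` of `K` to `R`. -/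
def typeHom (R : SmoothRep S) (K : Subgroup G) {n : ℕ} (σ : K →* Matrix (Fin n) (Fin n) ℂ) :
    Submodule ℂ ((Fin n → ℂ) →ₗ[ℂ] R.V) where
  carrier := {f | ∀ (k : K) (w : Fin n → ℂ), f (σ k *ᵥ w) = R.π (k : G) (f w)}
  add_mem' := by
    intro f f' hf hf' k w
    simp [hf k w, hf' k w]
  zero_mem' := by
    intro k w
    simp
  smul_mem' := by
    intro a f hf k w
    simp [hf k w]

/-- Admissibility: for a maximal compact subgroup `K`, every finite-dimensional continuous
representation of `K` (equivalently, every irreducible one) occurs with finite multiplicity. -/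
def IsAdmissible (R : SmoothRep S) : Prop :=
  ∀ K : Subgroup G, Maximal (fun K' : Subgroup G => IsCompact (K' : Set G)) K →
    ∀ (n : ℕ) (σ : K →* Matrix (Fin n) (Fin n) ℂ), Continuous σ →
      Module.Finite ℂ (R.typeHom K σ)

/-- Moderate growth, with respect to the norm of the matrix `p g`. -/
def HasModerateGrowth (R : SmoothRep S) : Prop :=
  ∀ q : Seminorm ℂ R.V, Continuous q → ∃ (d : ℕ) (q' : Seminorm ℂ R.V), Continuous q' ∧
    ∀ (g : G) (v : R.V), q (R.π g v) ≤
      (∑ i, ∑ j, ‖(S.p g : Matrix (Fin 2) (Fin 2) ℂ) i j‖) ^ d * q' v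

/-- `R` has infinitesimal character `l`. The centre of the enveloping algebra is generated by the
Casimir element, which has to act by `l² - 1`. -/
def HasInfChar (R : SmoothRep S) (l : ℂ) : Prop :=
  casimir R.dπ = (l ^ 2 - 1) • (1 : Module.End ℂ R.V)

/-- The action of `g` on `R ⊗ ℂ²`. A pair `u : Fin 2 → V` stands for `u 0 ⊗ f₊ + u 1 ⊗ f₋`, where
`f₊, f₋` is the standard basis of `ℂ²`. -/
def tensorAct (R : SmoothRep S) (g : G) (u : Fin 2 → R.V) : Fin 2 → R.V :=
  fun i => ∑ j, (S.p g : Matrix (Fin 2) (Fin 2) ℂ) i j • R.π g (u j)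

/-- The differentiated action of `sl2` on `R ⊗ ℂ²`. -/
def tensorLie (R : SmoothRep S) (A : sl2) : Module.End ℂ (Fin 2 → R.V) :=
  LinearMap.pi fun i => R.dπ A ∘ₗ LinearMap.proj i +
    ∑ j, (A : Matrix (Fin 2) (Fin 2) ℂ) i j • LinearMap.proj j

/-- The primary component of `R ⊗ ℂ²` with generalized infinitesimal character `l`. -/
def primary (R : SmoothRep S) (l : ℂ) : Submodule ℂ (Fin 2 → R.V) :=
  Module.End.maxGenEigenspace (casimir R.tensorLie) (l ^ 2 - 1)

/-- The primary component of `R ⊗ ℂ²` for `l` is isomorphic, as a topological `G`-module,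
to `R'`. -/
def PrimaryIso (R : SmoothRep S) (l : ℂ) (R' : SmoothRep S) : Prop :=
  ∃ ψ : R'.V ≃L[ℂ] R.primary l, ∀ (g : G) (v : R'.V),
    (ψ (R'.π g v) : Fin 2 → R.V) = R.tensorAct g (ψ v)

end SmoothRep

/-- The category of admissible smooth representations of finite length and moderate growth on
Fréchet spaces. -/
structure MRep (S : Sl2Group G) extends SmoothRep S where
  finiteLength : toSmoothRep.IsFiniteLength
  admissible : toSmoothRep.IsAdmissible
  moderateGrowth : toSmoothRep.HasModerateGrowth

/-- Symmetry breaking operators: continuous `G'`-homomorphisms from `R` to the character of `G'`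
whose differential maps `H` to `ν`. That character maps `γ t` to `exp (c ν t)`; if this is not
well defined on `G'`, the space is zero. -/
def symmetryBreaking (S : Sl2Gl1Pair G) (R : SmoothRep S.toSl2Group) (ν : ℂ) :
    Submodule ℂ (R.V →L[ℂ] ℂ) where
  carrier := {T | ∀ (t : ℝ) (v : R.V),
    T (R.π (S.γ t) v) = Complex.exp (S.c * ν * t) * T v}
  add_mem' := by
    intro T T' hT hT' t v
    simp [hT t v, hT' t v, mul_add]
  zero_mem' := by
    intro t v
    simp
  smul_mem' := by
    intro a T hT t v
    simp [hT t v, mul_left_comm]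

/-- The multiplicity of the character with parameter `ν` in the restriction of `R` to `G'`. -/
def mult (S : Sl2Gl1Pair G) (R : MRep S.toSl2Group) (ν : ℂ) : Cardinal :=
  Module.rank ℂ (symmetryBreaking S R.toSmoothRep ν)

end Representations

/-- `z` is an integer. -/
def IsInt (z : ℂ) : Prop := ∃ k : ℤ, z = k

/-- `z` is an odd integer. -/
def IsOddInt (z : ℂ) : Prop := ∃ k : ℤ, z = 2 * k + 1

/-- The parameter set `Λ(ξ)`: `ξ + ℤ`, or the positive integers, or the negative integers. -/
def Lam (ξ : ℂ) : Set ℂ :=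
  {l | (¬ IsInt ξ ∧ ∃ m : ℤ, l = ξ + m) ∨
    ((∃ k : ℕ, 0 < k ∧ ξ = k) ∧ ∃ m : ℕ, 0 < m ∧ l = m) ∨
    ((∃ k : ℕ, 0 < k ∧ ξ = -k) ∧ ∃ m : ℕ, 0 < m ∧ l = -m)}

/-- A reduced coherent family through the representation `R` with infinitesimal character `ξ`. -/
structure IsReducedCoherent {G : Type*} [Group G] [TopologicalSpace G] [IsTopologicalGroup G]
    [T2Space G] {S : Sl2Group G} (ξ : ℂ) (R : MRep S) (F : Lam ξ → MRep S) : Prop where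
  base : ∀ l : Lam ξ, (l : ℂ) = ξ → F l = R
  infChar : ∀ l : Lam ξ, (F l).HasInfChar l
  translate : ∀ l m : Lam ξ, ((m : ℂ) = l + 1 ∨ (m : ℂ) = l - 1) →
    (F l).PrimaryIso m (F m).toSmoothRep

/-- The set `Ξ` of pairs `(λ, ν)` with `λ ∈ Λ(ξ)`, `ν ∈ ℤ + η` and with
`(λ - ξ) - (ν - η)` even. -/
def Xi (ξ η : ℂ) : Set (ℂ × ℂ) :=
  {x | x.1 ∈ Lam ξ ∧ ∃ m n : ℤ, x.1 = ξ + m ∧ x.2 = η + n ∧ Even (m - n)}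

/-- Labels of the four regions. -/
inductive Dir
  | up
  | right
  | down
  | left

/-- The four regions of the parameter plane. -/
def quadrant : Dir → Set (ℂ × ℂ)
  | .up => {x | |x.1.re| + 1 ≤ x.2.re}
  | .right => {x | |x.2.re| + 1 ≤ x.1.re}
  | .down => {x | x.2.re ≤ -|x.1.re| - 1}
  | .left => {x | x.1.re ≤ -|x.2.re| - 1}

/-- The multiplicities of the family `F` are constant on `D`, equal to that of `R` at `η`. -/
def ConstOn {G : Type*} [Group G] [TopologicalSpace G] [IsTopologicalGroup G]
    [T2Space G] (S : Sl2Gl1Pair G) {ξ : ℂ} (R : MRep S.toSl2Group)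
    (F : Lam ξ → MRep S.toSl2Group) (η : ℂ) (D : Set (ℂ × ℂ)) : Prop :=
  ∀ (l : Lam ξ) (ν : ℂ), ((l : ℂ), ν) ∈ D → mult S (F l) ν = mult S R η

end

end Sl2Branching

namespace Sl2Branching

/-! Let `T` be a symmetry breaking operator from Π_λ to ℂ_ν, and let ε, δ ∈ {1, -1}. Applying `T` to
the coordinate of weight δ in Π_λ ⊗ ℂ² and restricting to the primary component for λ + ε, a copy of
Π_{λ+ε}, gives an operator to ℂ_{ν+δ}. On the Casimir projection of v ⊗ f± its value is, up to
scaling, (ελ + δν + 1) T v, so the passage is injective unless ελ + δν = -1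
(`rank_symmetryBreaking_le`). The step back from (λ + 1, ν + δ) to (λ, ν) has the factor -(λ + δν +
1). Hence the multiplicities at both ends agree unless λ + δν jumps from -1 to 1
(`IsReducedCoherent.mult_eq`).

Each step changes just one of λ + ν and λ - ν, by 2. So multiplicities can change only where one of
these is an odd integer and changes sign. Points of Ξ without such a sign change are joined by a
path that stays over Λ(ξ) (`eq_of_lattice_path`), and the three assertions are instances of
`IsReducedCoherent.mult_eq_base`. -/

theorem coe_H : (H : Matrix (Fin 2) (Fin 2) ℂ) = !![1, 0; 0, -1] := rfl

theorem coe_X : (X : Matrix (Fin 2) (Fin 2) ℂ) = !![0, 1; 0, 0] := rfl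

theorem coe_Y : (Y : Matrix (Fin 2) (Fin 2) ℂ) = !![0, 0; 1, 0] := rfl

theorem lie_X_Y : ⁅X, Y⁆ = H := by
  apply Subtype.ext
  change (X : Matrix (Fin 2) (Fin 2) ℂ) * Y - (Y : Matrix (Fin 2) (Fin 2) ℂ) * X = H
  rw [coe_X, coe_Y, coe_H]
  ext i j
  fin_cases i <;> fin_cases j <;> simp

theorem lie_H_X : ⁅H, X⁆ = (2 : ℂ) • X := by
  apply Subtype.ext
  change (H : Matrix (Fin 2) (Fin 2) ℂ) * X - (X : Matrix (Fin 2) (Fin 2) ℂ) * H =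
    (2 : ℂ) • (X : Matrix (Fin 2) (Fin 2) ℂ)
  rw [coe_X, coe_H]
  ext i j
  fin_cases i <;> fin_cases j <;> norm_num

theorem lie_H_Y : ⁅H, Y⁆ = (-2 : ℂ) • Y := by
  apply Subtype.ext
  change (H : Matrix (Fin 2) (Fin 2) ℂ) * Y - (Y : Matrix (Fin 2) (Fin 2) ℂ) * H =
    (-2 : ℂ) • (Y : Matrix (Fin 2) (Fin 2) ℂ)
  rw [coe_Y, coe_H]
  ext i j
  fin_cases i <;> fin_cases j <;> norm_num

/-! ### The Casimir element on R ⊗ ℂ² -/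

section Representations

variable {G : Type*} [Group G] [TopologicalSpace G] [IsTopologicalGroup G] [T2Space G]

namespace SmoothRep

variable {S : Sl2Group G} (R : SmoothRep S)

theorem dπ_X_dπ_Y (v : R.V) : R.dπ X (R.dπ Y v) = R.dπ Y (R.dπ X v) + R.dπ H v := by
  have h := congrArg (fun f : Module.End ℂ R.V => f v) (R.dπ_lie X Y)
  simp only [lie_X_Y, LinearMap.sub_apply, Module.End.mul_apply] at h
  rw [h]
  abel

theorem dπ_H_dπ_X (v : R.V) : R.dπ H (R.dπ X v) = R.dπ X (R.dπ H v) + (2 : ℂ) • R.dπ X v := by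
  have h := congrArg (fun f : Module.End ℂ R.V => f v) (R.dπ_lie H X)
  simp only [lie_H_X, map_smul, LinearMap.smul_apply, LinearMap.sub_apply,
    Module.End.mul_apply] at h
  rw [h]
  abel

theorem dπ_H_dπ_Y (v : R.V) : R.dπ H (R.dπ Y v) = R.dπ Y (R.dπ H v) - (2 : ℂ) • R.dπ Y v := by
  have h := congrArg (fun f : Module.End ℂ R.V => f v) (R.dπ_lie H Y)
  simp only [lie_H_Y, map_smul, LinearMap.smul_apply, LinearMap.sub_apply,
    Module.End.mul_apply] at h
  rw [sub_eq_add_neg, ← neg_smul, h]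
  abel

variable {R}

theorem HasInfChar.dπ_H_dπ_H {l : ℂ} (h : R.HasInfChar l) (v : R.V) :
    R.dπ H (R.dπ H v) =
      (l ^ 2 - 1) • v - (2 : ℂ) • R.dπ H v - (4 : ℂ) • R.dπ Y (R.dπ X v) := by
  have h := congrArg (fun f : Module.End ℂ R.V => f v) h
  simp only [casimir, LinearMap.add_apply, Module.End.mul_apply, LinearMap.smul_apply,
    R.dπ_X_dπ_Y, Module.End.one_apply] at h
  rw [← h]
  module

variable (R)

theorem tensorLie_H (u : Fin 2 → R.V) :
    R.tensorLie H u = ![R.dπ H (u 0) + u 0, R.dπ H (u 1) - u 1] := by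
  ext i
  fin_cases i <;> simp [tensorLie, coe_H, sub_eq_add_neg]

theorem tensorLie_X (u : Fin 2 → R.V) :
    R.tensorLie X u = ![R.dπ X (u 0) + u 1, R.dπ X (u 1)] := by
  ext i
  fin_cases i <;> simp [tensorLie, coe_X]

theorem tensorLie_Y (u : Fin 2 → R.V) :
    R.tensorLie Y u = ![R.dπ Y (u 0), R.dπ Y (u 1) + u 0] := by
  ext i
  fin_cases i <;> simp [tensorLie, coe_Y]

variable {R}

theorem HasInfChar.casimir_tensorLie {l : ℂ} (h : R.HasInfChar l) (u : Fin 2 → R.V) :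
    casimir R.tensorLie u =
      ![(l ^ 2 + 2) • u 0 + (2 : ℂ) • R.dπ H (u 0) + (4 : ℂ) • R.dπ Y (u 1),
        (l ^ 2 + 2) • u 1 - (2 : ℂ) • R.dπ H (u 1) + (4 : ℂ) • R.dπ X (u 0)] := by
  ext i
  fin_cases i <;>
  · simp [casimir, tensorLie_H, tensorLie_X, tensorLie_Y, h.dπ_H_dπ_H, R.dπ_X_dπ_Y]
    module

theorem mem_primary_of_casimir_eq {m : ℂ} {u : Fin 2 → R.V}
    (h : casimir R.tensorLie u = (m ^ 2 - 1) • u) : u ∈ R.primary m :=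
  (casimir R.tensorLie).genEigenspace _ |>.mono le_top (Module.End.mem_eigenspace_iff.2 h)

/-- The vector is half of Ω - ((l - ε)² - 1) applied to v ⊗ f₊. This operator maps into the
eigenspace for l + ε, because Ω on R ⊗ ℂ² is annihilated by the product of the two factors for l ±
1. -/
theorem HasInfChar.mem_primary_left {l ε : ℂ} (h : R.HasInfChar l) (hε : ε ^ 2 = 1) (v : R.V) :
    ![(1 + ε * l) • v + R.dπ H v, (2 : ℂ) • R.dπ X v] ∈ R.primary (l + ε) := by
  have e : (l + ε) ^ 2 - 1 = l ^ 2 + 2 * ε * l := by linear_combination hε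
  apply mem_primary_of_casimir_eq
  rw [h.casimir_tensorLie, e]
  ext i
  fin_cases i
  · simp [h.dπ_H_dπ_H]
    match_scalars
    · linear_combination (-2 * l ^ 2) * hε
    all_goals ring
  · simp [R.dπ_H_dπ_X]
    module

/-- The same projection, applied to v ⊗ f₋. -/
theorem HasInfChar.mem_primary_right {l ε : ℂ} (h : R.HasInfChar l) (hε : ε ^ 2 = 1) (v : R.V) :
    ![(2 : ℂ) • R.dπ Y v, (1 + ε * l) • v - R.dπ H v] ∈ R.primary (l + ε) := by
  have e : (l + ε) ^ 2 - 1 = l ^ 2 + 2 * ε * l := by linear_combination hε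
  apply mem_primary_of_casimir_eq
  rw [h.casimir_tensorLie, e]
  ext i
  fin_cases i
  · simp [R.dπ_H_dπ_Y]
    module
  · simp [h.dπ_H_dπ_H, R.dπ_X_dπ_Y]
    match_scalars
    · linear_combination (-2 * l ^ 2) * hε
    all_goals ring

end SmoothRep

/-! ### Translation of symmetry breaking operators -/

section Restriction

variable (S : Sl2Gl1Pair G)

theorem coe_p_γ (t : ℝ) : (S.p (S.γ t) : Matrix (Fin 2) (Fin 2) ℂ) =
    Matrix.diagonal ![Complex.exp (S.c * t), Complex.exp (-(S.c * t))] := by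
  have e : (t : ℂ) • ((S.c • H : sl2) : Matrix (Fin 2) (Fin 2) ℂ) =
      Matrix.diagonal ![S.c * t, -(S.c * t)] := by
    change (t : ℂ) • S.c • (H : Matrix (Fin 2) (Fin 2) ℂ) = _
    rw [coe_H]
    ext i j
    fin_cases i <;> fin_cases j <;> simp [mul_comm]
  rw [S.isOneParam_γ.map_exp, e, Matrix.exp_diagonal]
  congr 1
  ext i
  rw [Pi.coe_exp, ← Complex.exp_eq_exp_ℂ]
  fin_cases i <;> rfl

variable {S} {R R' : SmoothRep S.toSl2Group}

/-- Differentiate the equivariance along `γ` at t = 0 and cancel the nonzero factor `c`. -/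
theorem symmetryBreaking_dπ_H {ν : ℂ} {T : R.V →L[ℂ] ℂ} (hT : T ∈ symmetryBreaking S R ν)
    (v : R.V) : T (R.dπ H v) = ν * T v := by
  have h1 := (T.continuous.tendsto _).comp (R.hasDeriv _ _ S.isOneParam_γ v)
  have h2 : HasDerivAt (fun t : ℝ => Complex.exp (S.c * ν * t)) (S.c * ν) 0 := by
    have h : HasDerivAt (fun t : ℂ => Complex.exp (S.c * ν * t)) (S.c * ν) ((0 : ℝ) : ℂ) := by
      simpa using ((hasDerivAt_id (0 : ℂ)).const_mul (S.c * ν)).cexp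
    exact h.comp_ofReal
  have h3 := (hasDerivAt_iff_tendsto_slope.1 h2).mul_const (T v)
  have h4 := tendsto_nhds_unique h1 (h3.congr fun t => ?_)
  · rw [map_smul, LinearMap.smul_apply, map_smul, smul_eq_mul, mul_assoc] at h4
    exact mul_left_cancel₀ S.c_ne_zero h4
  · simp [slope_def_module, hT t v]
    ring

/-- A coordinate of `R ⊗ ℂ²` followed by a symmetry breaking operator of `R`, as a linear map from
symmetry breaking operators of `R` to functionals on a component of `R ⊗ ℂ²`. -/
noncomputable def translation {m : ℂ} (ψ : R'.V ≃L[ℂ] R.primary m) (i : Fin 2) :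
    (R.V →L[ℂ] ℂ) →ₗ[ℂ] (R'.V →L[ℂ] ℂ) where
  toFun T := T ∘L ContinuousLinearMap.proj i ∘L (R.primary m).subtypeL ∘L
    (ψ : R'.V →L[ℂ] R.primary m)
  map_add' _ _ := rfl
  map_smul' _ _ := rfl

theorem translation_mem {m ν : ℂ} (ψ : R'.V ≃L[ℂ] R.primary m)
    (hψ : ∀ (g : G) (v : R'.V), (ψ (R'.π g v) : Fin 2 → R.V) = R.tensorAct g (ψ v))
    (i : Fin 2) {T : R.V →L[ℂ] ℂ} (hT : T ∈ symmetryBreaking S R ν) :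
    translation ψ i T ∈ symmetryBreaking S R' (ν + ![1, -1] i) := by
  intro t v
  change T ((ψ (R'.π (S.γ t) v) : Fin 2 → R.V) i) = _ * T ((ψ v : Fin 2 → R.V) i)
  rw [hψ, SmoothRep.tensorAct, Finset.sum_eq_single i]
  · rw [map_smul, hT, coe_p_γ, Matrix.diagonal_apply_eq, smul_eq_mul, ← mul_assoc]
    congr 1
    fin_cases i <;> simp [← Complex.exp_add] <;> ring_nf
  · intro j _ hj
    rw [coe_p_γ, Matrix.diagonal_apply_ne _ hj.symm, zero_smul]
  · simp

theorem rank_symmetryBreaking_le {l m ε ν ν' : ℂ} (hR : R.HasInfChar l) (hε : ε ^ 2 = 1)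
    (hm : m = l + ε) (hRR' : R.PrimaryIso m R') (i : Fin 2) (hν : ν' = ν + ![1, -1] i)
    (hne : ε * l + ![1, -1] i * ν + 1 ≠ 0) :
    Module.rank ℂ (symmetryBreaking S R ν) ≤ Module.rank ℂ (symmetryBreaking S R' ν') := by
  obtain ⟨ψ, hψ⟩ := hRR'
  subst hν hm
  refine LinearMap.rank_le_of_injective
    ((translation ψ i).restrict fun T hT => translation_mem ψ hψ i hT)
    ((injective_iff_map_eq_zero _).2 ?_)
  rintro ⟨T, hT⟩ h0
  -- Since `ψ` is onto the primary component, `T` kills the `i`-th coordinate of all of it, in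
  -- particular of the explicit Casimir projections.
  have h1 (u : R.primary (l + ε)) : T ((u : Fin 2 → R.V) i) = 0 := by
    have h := congrArg (fun f : symmetryBreaking S R' _ => (f : R'.V →L[ℂ] ℂ) (ψ.symm u)) h0
    change T ((ψ (ψ.symm u) : Fin 2 → R.V) i) = 0 at h
    rwa [ψ.apply_symm_apply] at h
  apply Subtype.ext
  ext v
  change T v = 0
  refine (mul_eq_zero.1 ?_).resolve_left hne
  fin_cases i
  · have h := h1 ⟨_, hR.mem_primary_left hε v⟩
    simp [symmetryBreaking_dπ_H hT] at h
    change (ε * l + 1 * ν + 1) * T v = 0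
    linear_combination h
  · have h := h1 ⟨_, hR.mem_primary_right hε v⟩
    simp [symmetryBreaking_dπ_H hT] at h
    change (ε * l + -1 * ν + 1) * T v = 0
    linear_combination h

end Restriction

variable {S : Sl2Gl1Pair G} {ξ : ℂ} {R : MRep S.toSl2Group} {F : Lam ξ → MRep S.toSl2Group}

theorem IsReducedCoherent.mult_eq (hF : IsReducedCoherent ξ R F) {l m : Lam ξ} {ν ν' : ℂ}
    (hm : (m : ℂ) = l + 1) (i : Fin 2) (hν : ν' = ν + ![1, -1] i)
    (hne : l + ![1, -1] i * ν ≠ -1) : mult S (F l) ν = mult S (F m) ν' := by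
  apply le_antisymm
  · refine rank_symmetryBreaking_le (hF.infChar l) (one_pow 2) hm (hF.translate l m (Or.inl hm)) i
      hν fun h => hne ?_
    linear_combination h
  · have hl : (l : ℂ) = m - 1 := by rw [hm]; ring
    have hi : (![1, -1] i : ℂ) * ![1, -1] i = 1 := by fin_cases i <;> simp
    have hi' : (![1, -1] (1 - i) : ℂ) = -![1, -1] i := by fin_cases i <;> simp
    -- The way back uses the opposite coordinate; by δ² = 1 its factor is the negative of the
    -- forward one.
    refine rank_symmetryBreaking_le (hF.infChar m) (ε := -1) (by norm_num) (by rw [hl]; ring)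
      (hF.translate m l (Or.inr hl)) (1 - i) ?_ fun h => hne ?_
    · rw [hi', hν]; ring
    · rw [hi', hν, hm] at h
      linear_combination -h - hi

/-! ### Paths in the parameter lattice -/

theorem Lam_monotone_or_antitone (ξ : ℂ) :
    (∀ k n : ℤ, k ≤ n → ξ + k ∈ Lam ξ → ξ + n ∈ Lam ξ) ∨
      ∀ k n : ℤ, k ≤ n → ξ + n ∈ Lam ξ → ξ + k ∈ Lam ξ := by
  by_cases hξ : IsInt ξ
  · obtain ⟨x, rfl⟩ := hξ
    have hpos (hx : 0 < x) (k : ℤ) : (x : ℂ) + k ∈ Lam x ↔ 0 < x + k := by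
      constructor
      · rintro (⟨h, -⟩ | ⟨-, m, hm, h⟩ | ⟨⟨m, hm, h⟩, -⟩)
        · exact absurd ⟨x, rfl⟩ h
        · have : x + k = m := by exact_mod_cast h
          lia
        · have : x = -m := by exact_mod_cast h
          lia
      · intro h
        refine Or.inr (Or.inl ⟨⟨x.toNat, by lia, ?_⟩, (x + k).toNat, by lia, ?_⟩)
        · rw [← Int.cast_natCast, Int.toNat_of_nonneg hx.le]
        · rw [← Int.cast_natCast, Int.toNat_of_nonneg h.le, Int.cast_add]
    -- For x = 0 the set Λ is empty, so this case is vacuous and can be merged with x < 0.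
    have hneg (hx : x ≤ 0) (k : ℤ) (h : (x : ℂ) + k ∈ Lam x) : x < 0 ∧ x + k < 0 := by
      rcases h with ⟨h, -⟩ | ⟨⟨m, hm, h⟩, -⟩ | ⟨⟨n, hn, h'⟩, m, hm, h⟩
      · exact absurd ⟨x, rfl⟩ h
      · have : x = m := by exact_mod_cast h
        lia
      · have : x = -n := by exact_mod_cast h'
        have : x + k = -m := by exact_mod_cast h
        lia
    rcases lt_or_ge 0 x with hx | hx
    · left
      intro k n hkn hk
      rw [hpos hx] at *
      lia
    · right
      intro k n hkn hn
      obtain ⟨h0, hn⟩ := hneg hx n hn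
      refine Or.inr (Or.inr ⟨⟨(-x).toNat, by lia, ?_⟩, (-(x + k)).toNat, by lia, ?_⟩)
      · rw [← Int.cast_natCast, Int.toNat_of_nonneg (by lia)]
        simp
      · rw [← Int.cast_natCast, Int.toNat_of_nonneg (by lia)]
        push_cast
        ring
  · exact Or.inl fun k n _ _ => Or.inl ⟨hξ, n, rfl⟩

theorem self_mem_Lam {ξ : ℂ} (hξ : ξ ≠ 0) : ξ ∈ Lam ξ := by
  by_cases h : IsInt ξ
  · obtain ⟨x, rfl⟩ := h
    have hx : x ≠ 0 := by exact_mod_cast hξ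
    rcases lt_or_gt_of_ne hx with hx | hx
    · have e : (x : ℂ) = -((-x).toNat : ℕ) := by
        rw [← Int.cast_natCast, Int.toNat_of_nonneg (by lia)]
        simp
      exact Or.inr (Or.inr ⟨⟨_, by lia, e⟩, _, by lia, e⟩)
    · have e : (x : ℂ) = (x.toNat : ℕ) := by
        rw [← Int.cast_natCast, Int.toNat_of_nonneg (by lia)]
      exact Or.inr (Or.inl ⟨⟨_, by lia, e⟩, _, by lia, e⟩)
  · exact Or.inl ⟨h, 0, by simp⟩

theorem eq_of_forall_eq_succ {α : Type*} {g : ℤ → α} {a b : ℤ} (hab : a ≤ b)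
    (h : ∀ k, a ≤ k → k < b → g k = g (k + 1)) : g a = g b := by
  induction b, hab using Int.leInduction with
  | base => rfl
  | succ n hn ih => exact (ih fun k hk hkn => h k hk (by lia)).trans (h n hn (by lia))

/-- `V` is the constraint λ ∈ Λ(ξ). If it is closed upwards, pass through the corner (max 0 i, max 0
j): the coordinate sum stays ≥ 0 on the way out and ≥ i + j on the way back. If it is closed
downwards, use the minima. -/
theorem eq_of_lattice_path {α : Type*} {g : ℤ → ℤ → α} {V A B : ℤ → Prop}
    (hi : ∀ i j, V (i + j) → V (i + j + 1) → A i → g i j = g (i + 1) j)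
    (hj : ∀ i j, V (i + j) → V (i + j + 1) → B j → g i j = g i (j + 1))
    (hV : (∀ k n, k ≤ n → V k → V n) ∨ ∀ k n, k ≤ n → V n → V k) {i j : ℤ}
    (h0 : V 0) (hij : V (i + j)) (hA : ∀ k, min 0 i ≤ k → k < max 0 i → A k)
    (hB : ∀ k, min 0 j ≤ k → k < max 0 j → B k) : g 0 0 = g i j := by
  rcases hV with hV | hV
  · calc
      g 0 0 = g (max 0 i) 0 := eq_of_forall_eq_succ (g := (g · 0)) (by lia) fun k h1 h2 =>
        hi k 0 (hV 0 _ (by lia) h0) (hV 0 _ (by lia) h0) (hA k (by lia) (by lia))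
      _ = g (max 0 i) (max 0 j) := eq_of_forall_eq_succ (by lia) fun k h1 h2 =>
        hj _ k (hV 0 _ (by lia) h0) (hV 0 _ (by lia) h0) (hB k (by lia) (by lia))
      _ = g i (max 0 j) := .symm <| eq_of_forall_eq_succ (g := (g · (max 0 j))) (by lia)
        fun k h1 h2 => hi k _ (hV (i + j) _ (by lia) hij) (hV (i + j) _ (by lia) hij)
          (hA k (by lia) (by lia))
      _ = g i j := .symm <| eq_of_forall_eq_succ (by lia) fun k h1 h2 =>
        hj i k (hV (i + j) _ (by lia) hij) (hV (i + j) _ (by lia) hij) (hB k (by lia) (by lia))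
  · calc
      g 0 0 = g (min 0 i) 0 := .symm <| eq_of_forall_eq_succ (g := (g · 0)) (by lia)
        fun k h1 h2 => hi k 0 (hV _ 0 (by lia) h0) (hV _ 0 (by lia) h0) (hA k (by lia) (by lia))
      _ = g (min 0 i) (min 0 j) := .symm <| eq_of_forall_eq_succ (by lia) fun k h1 h2 =>
        hj _ k (hV _ 0 (by lia) h0) (hV _ 0 (by lia) h0) (hB k (by lia) (by lia))
      _ = g i (min 0 j) := eq_of_forall_eq_succ (g := (g · (min 0 j))) (by lia)
        fun k h1 h2 => hi k _ (hV _ (i + j) (by lia) hij) (hV _ (i + j) (by lia) hij)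
          (hA k (by lia) (by lia))
      _ = g i j := eq_of_forall_eq_succ (by lia) fun k h1 h2 =>
        hj i k (hV _ (i + j) (by lia) hij) (hV _ (i + j) (by lia) hij) (hB k (by lia) (by lia))

/-- If a + 2k = -1, then a is odd and the step from k to k + 1 leads from -1 to 1; as it lies
between 0 and i, the ends a and a + 2i have opposite signs. -/
theorem add_two_mul_ne_neg_one {a : ℂ} {i k : ℤ}
    (h : IsOddInt a → 0 < (a + 2 * i).re * a.re) (h1 : min 0 i ≤ k) (h2 : k < max 0 i) :
    a + 2 * k ≠ -1 := by
  intro e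
  have ha : a = ((-2 * k - 1 : ℤ) : ℂ) := by
    push_cast
    linear_combination e
  have h := h ⟨-k - 1, by rw [ha]; push_cast; ring⟩
  have e' : a + 2 * i = ((-2 * k - 1 + 2 * i : ℤ) : ℂ) := by
    rw [ha]
    push_cast
    ring
  rw [e', ha, Complex.intCast_re, Complex.intCast_re] at h
  have h : 0 < (-2 * k - 1 + 2 * i) * (-2 * k - 1) := by exact_mod_cast h
  rcases lt_or_ge k 0 with hk | hk
  · nlinarith [show 2 * i - 2 * k - 1 < 0 by lia]
  · nlinarith [show 0 < 2 * i - 2 * k - 1 by lia]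

theorem IsReducedCoherent.mult_eq_base (hξ : ξ ≠ 0) (hF : IsReducedCoherent ξ R F) {η ν : ℂ}
    {l : Lam ξ} (h : ((l : ℂ), ν) ∈ Xi ξ η)
    (hadd : IsOddInt (ξ + η) → 0 < (l + ν).re * (ξ + η).re)
    (hsub : IsOddInt (ξ - η) → 0 < (l - ν).re * (ξ - η).re) :
    mult S (F l) ν = mult S R η := by
  classical
  obtain ⟨hl, m, n, hm, hn, r, hr⟩ := h
  obtain ⟨l, _⟩ := l
  obtain rfl : m = n + r + r := by lia
  dsimp only at hm hn hl hadd hsub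
  subst hm hn
  -- Here i counts steps (1, 1) and j steps (1, -1); the target (n + 2r, n) is i = n + r, j = r. The
  -- value 0 off Λ(ξ) is never compared.
  let g (i j : ℤ) : Cardinal := if h : ξ + (i + j : ℤ) ∈ Lam ξ then
    mult S (F ⟨ξ + (i + j : ℤ), h⟩) (η + (i - j : ℤ)) else 0
  have e : g 0 0 = g (n + r) r := by
    refine eq_of_lattice_path (V := fun k => ξ + k ∈ Lam ξ) (A := fun k => ξ + η + 2 * k ≠ -1)
      (B := fun k => ξ - η + 2 * k ≠ -1) ?_ ?_ (Lam_monotone_or_antitone ξ)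
      (by simpa using self_mem_Lam hξ) hl ?_ ?_
    · intro i j h h' hA
      have h'' : ξ + (i + 1 + j : ℤ) ∈ Lam ξ := by rwa [add_right_comm]
      simp only [g, dif_pos h, dif_pos h'']
      refine hF.mult_eq ?_ 0 ?_ fun e => hA ?_
      · push_cast; ring
      · simp; ring
      · simp at e
        linear_combination e
    · intro i j h h' hB
      have h'' : ξ + (i + (j + 1) : ℤ) ∈ Lam ξ := by rwa [← add_assoc]
      simp only [g, dif_pos h, dif_pos h'']
      refine hF.mult_eq ?_ 1 ?_ fun e => hB ?_
      · push_cast; ring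
      · simp; ring
      · simp at e
        linear_combination e
    · intro k h1 h2
      refine add_two_mul_ne_neg_one (fun h => ?_) h1 h2
      convert hadd h using 3
      push_cast
      ring
    · intro k h1 h2
      refine add_two_mul_ne_neg_one (fun h => ?_) h1 h2
      convert hsub h using 3
      push_cast
      ring
  have h0 : ξ + ((0 + 0 : ℤ) : ℂ) ∈ Lam ξ := by simpa using self_mem_Lam hξ
  simp only [g, dif_pos h0, dif_pos hl] at e
  rw [hF.base ⟨_, h0⟩ (by simp)] at e
  convert e.symm using 2 <;> simp

/-! ### The regions of constancy -/

theorem isInt_of_isOddInt_add_of_isOddInt_sub {ξ η : ℂ} (h : IsOddInt (ξ + η))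
    (h' : IsOddInt (ξ - η)) : IsInt ξ := by
  obtain ⟨j, hj⟩ := h
  obtain ⟨k, hk⟩ := h'
  refine ⟨j + k + 1, ?_⟩
  push_cast
  linear_combination (hj + hk) / 2

/-- Each region fixes the signs of both Re(λ + ν) and Re(λ - ν). -/
theorem mul_re_pos_of_mem_quadrant {s : Dir} {x y : ℂ × ℂ} (hx : x ∈ quadrant s)
    (hy : y ∈ quadrant s) :
    0 < (x.1 + x.2).re * (y.1 + y.2).re ∧ 0 < (x.1 - x.2).re * (y.1 - y.2).re := by
  simp only [Complex.add_re, Complex.sub_re]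
  have hx1 := le_abs_self x.1.re
  have hx2 := neg_abs_le x.1.re
  have hx3 := le_abs_self x.2.re
  have hx4 := neg_abs_le x.2.re
  have hy1 := le_abs_self y.1.re
  have hy2 := neg_abs_le y.1.re
  have hy3 := le_abs_self y.2.re
  have hy4 := neg_abs_le y.2.re
  cases s <;> simp only [quadrant, Set.mem_ofPred_eq] at hx hy
  · exact ⟨mul_pos (by linarith) (by linarith), mul_pos_of_neg_of_neg (by linarith) (by linarith)⟩
  · exact ⟨mul_pos (by linarith) (by linarith), mul_pos (by linarith) (by linarith)⟩
  · exact ⟨mul_pos_of_neg_of_neg (by linarith) (by linarith), mul_pos (by linarith) (by linarith)⟩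
  · exact ⟨mul_pos_of_neg_of_neg (by linarith) (by linarith),
      mul_pos_of_neg_of_neg (by linarith) (by linarith)⟩

theorem exists_mem_quadrant {ξ η : ℂ} (hξ : IsInt ξ) (h : IsOddInt (ξ - η)) :
    ∃ s, (ξ, η) ∈ quadrant s := by
  obtain ⟨x, rfl⟩ := hξ
  obtain ⟨k, hk⟩ := h
  obtain rfl : η = ((x - 2 * k - 1 : ℤ) : ℂ) := by
    push_cast
    linear_combination -hk
  -- The two integers have different parity, so their absolute values differ by at least 1.
  have key : |x| + 1 ≤ x - 2 * k - 1 ∨ |x - 2 * k - 1| + 1 ≤ x ∨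
      x - 2 * k - 1 ≤ -|x| - 1 ∨ x ≤ -|x - 2 * k - 1| - 1 := by
    grind
  rcases key with h | h | h | h
  · exact ⟨.up, by simp only [quadrant, Set.mem_ofPred_eq, Complex.intCast_re]; exact_mod_cast h⟩
  · exact ⟨.right, by simp only [quadrant, Set.mem_ofPred_eq, Complex.intCast_re]; exact_mod_cast h⟩
  · exact ⟨.down, by simp only [quadrant, Set.mem_ofPred_eq, Complex.intCast_re]; exact_mod_cast h⟩
  · exact ⟨.left, by simp only [quadrant, Set.mem_ofPred_eq, Complex.intCast_re]; exact_mod_cast h⟩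

theorem self_mem_Xi {ξ : ℂ} (hξ : ξ ≠ 0) (η : ℂ) : (ξ, η) ∈ Xi ξ η :=
  ⟨self_mem_Lam hξ, 0, 0, by simp, by simp, by simp⟩

end Representations

end Sl2Branching

open Sl2Branching in
theorem mainTheorem3 {G : Type*} [Group G] [TopologicalSpace G] [IsTopologicalGroup G]
    [T2Space G] (S : Sl2Gl1Pair G) (ξ η : ℂ) (hξ : ξ ≠ 0) (R : MRep S.toSl2Group)
    (hR : R.HasInfChar ξ) (F : Lam ξ → MRep S.toSl2Group) (hF : IsReducedCoherent ξ R F) :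
    (¬ IsOddInt (ξ - η) → ¬ IsOddInt (ξ + η) → ConstOn S R F η (Xi ξ η)) ∧
    (IsOddInt (ξ - η) →
      (IsInt ξ → ∃ s : Dir, (ξ, η) ∈ Xi ξ η ∩ quadrant s) ∧
      ∀ s : Dir, (ξ, η) ∈ Xi ξ η ∩ quadrant s → ConstOn S R F η (Xi ξ η ∩ quadrant s)) ∧
    (¬ IsInt ξ →
      (IsOddInt (ξ - η) → ConstOn S R F η
        {x ∈ Xi ξ η | 0 < (x.1 - x.2).re * (ξ - η).re}) ∧
      (IsOddInt (ξ + η) → ConstOn S R F η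
        {x ∈ Xi ξ η | 0 < (x.1 + x.2).re * (ξ + η).re})) := by
  refine ⟨fun h1 h2 l ν h => hF.mult_eq_base hξ h (absurd · h2) (absurd · h1),
    fun h1 => ⟨fun hξ' => ?_, fun s hs l ν h => ?_⟩, fun hξ' => ⟨fun h1 l ν h => ?_,
      fun h1 l ν h => ?_⟩⟩
  · obtain ⟨s, hs⟩ := exists_mem_quadrant hξ' h1
    exact ⟨s, self_mem_Xi hξ η, hs⟩
  · have hpos := mul_re_pos_of_mem_quadrant h.2 hs.2
    exact hF.mult_eq_base hξ h.1 (fun _ => hpos.1) fun _ => hpos.2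
  · exact hF.mult_eq_base hξ h.1
      (fun h2 => absurd (isInt_of_isOddInt_add_of_isOddInt_sub h2 h1) hξ') fun _ => h.2
  · exact hF.mult_eq_base hξ h.1 (fun _ => h.2)
      fun h2 => absurd (isInt_of_isOddInt_add_of_isOddInt_sub h1 h2) hξ'
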